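/- Let $R$ be a complete discrete valuation ring with fraction field $K$ and algebraically closed residue field $k$ of characteristic $p>0$, and let $S=\operatorname{Spec}(R)$. For an $S$-scheme $Y$ write $Y_\eta=Y\times_S\operatorname{Spec}(K)$ and $Y_s=Y\times_S\operatorname{Spec}(k)$ for its generic and special fibers. An $S$-morphism $h:\tilde Y\to Y$ is called a model map if the induced morphism $h_\eta:\tilde Y_\eta\to Y_\eta$ is an isomorphism. For a closed subscheme $C$ of $Y_s$, with ideal sheaf $\mathcal I\subseteq\mathcal O_Y$ as a closed subscheme of $Y$, the Néron blowing up of $Y$ at $C$ is the affine morphism $Y^C\to Y$ which over each affine open $U=\operatorname{Spec}(A)$ of $Y$ is $\operatorname{Spec}(A[\pi^{-1}I])\to\operatorname{Spec}(A)$; here $I=\mathcal I(U)$, $\pi$ is a uniformizer of $R$, and $A[\pi^{-1}I]$ is the $A$-subalgebra of $A\otimes_R K$ generated by the elements $a/\pi$ with $a\in I$. Lemma 3.9. Let $Y$ and $\tilde Y$ be two schemes faithfully flat and of finite type over $S$, and let $h:\tilde Y\to Y$ be an affine model map. Then $h$ is isomorphic to a composite of finitely many Néron blowing ups: there exist an integer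 $n\ge 0$, a chain of $S$-morphisms $Y_n\to\cdots\to Y_1\to Y_0=Y$ in which each $Y_{j+1}\to Y_j$ is the Néron blowing up of $Y_j$ at a closed subscheme of its special fiber $(Y_j)_s$, and an isomorphism $\tilde Y\simeq Y_n$ whose composite with $Y_n\to Y$ is $h$. -/

import Mathlib

open CategoryTheory CategoryTheory.Limits AlgebraicGeometry
open scoped TensorProduct

universe u

noncomputable section

namespace NeronBlowup

/-- The algebra `A[π⁻¹I]`: the `A`-subalgebra of `A_K = A ⊗[R] K`, with `K` the fraction field of
`R`, generated by the elements `a / π` with `a ∈ I` and `π` a uniformizer of `R`. (Uniformizers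
differ by units of `R`, so letting `π` vary gives the same algebra as fixing one.) -/
def blowupAlgebra (R : Type u) [CommRing R] (A : Type u) [CommRing A] [Algebra R A]
    (I : Ideal A) : Subalgebra A (A ⊗[R] FractionRing R) :=
  Algebra.adjoin A
    {x | ∃ π : R, Irreducible π ∧ ∃ a ∈ I, π • x = a ⊗ₜ[R] (1 : FractionRing R)}

/-- Given ring homomorphisms `φ : R → A` and `ψ : A → B` and an ideal `I` of `A`, the `A`-algebra
`B` is isomorphic to `A[π⁻¹I]`. -/
def IsBlowupAlgebra {R A B : Type u} [CommRing R] [CommRing A] [CommRing B]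
    (φ : R →+* A) (I : Ideal A) (ψ : A →+* B) : Prop :=
  letI := φ.toAlgebra
  letI := ψ.toAlgebra
  Nonempty (B ≃ₐ[A] blowupAlgebra R A I)

section

variable (R : Type u) [CommRing R] [IsDomain R] [IsDiscreteValuationRing R]

/-- The base scheme `S = Spec R`. -/
abbrev base : Scheme.{u} := Spec (CommRingCat.of R)

/-- The generic point `η = Spec K ⟶ S`. -/
abbrev genericι : Spec (CommRingCat.of (FractionRing R)) ⟶ base R :=
  Spec.map (CommRingCat.ofHom (algebraMap R (FractionRing R)))

/-- The special point `s = Spec k ⟶ S`. -/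
abbrev specialι : Spec (CommRingCat.of (IsLocalRing.ResidueField R)) ⟶ base R :=
  Spec.map (CommRingCat.ofHom (IsLocalRing.residue R))

end

variable {R : Type u} [CommRing R] [IsDomain R] [IsDiscreteValuationRing R]

/-- The generic fiber `Y_η = Y ×_S Spec K` of an `S`-scheme `f : Y ⟶ S`. -/
abbrev genericFiber {Y : Scheme.{u}} (f : Y ⟶ base R) : Scheme.{u} := pullback f (genericι R)

/-- The morphism `h_η : Y'_η ⟶ Y_η` induced on generic fibers by an `S`-morphism `h : Y' ⟶ Y`,
where `Y` has structure morphism `f` and `Y'` has structure morphism `h ≫ f`. -/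
def genericFiberMap {Y' Y : Scheme.{u}} (f : Y ⟶ base R) (h : Y' ⟶ Y) :
    genericFiber (h ≫ f) ⟶ genericFiber f :=
  pullback.map (h ≫ f) (genericι R) f (genericι R) h (𝟙 _) (𝟙 _) (by simp) (by simp)

/-- An `S`-morphism is a model map if it is an isomorphism on generic fibers. -/
def IsModelMap {Y' Y : Scheme.{u}} (f : Y ⟶ base R) (h : Y' ⟶ Y) : Prop :=
  IsIso (genericFiberMap f h)

/-- The special fiber `Y_s = Y ×_S Spec k` of an `S`-scheme `f : Y ⟶ S`. -/
abbrev specialFiber {Y : Scheme.{u}} (f : Y ⟶ base R) : Scheme.{u} := pullback f (specialι R)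

/-- The inclusion `Y_s ⟶ Y` of the special fiber. -/
abbrev specialFiberι {Y : Scheme.{u}} (f : Y ⟶ base R) : specialFiber f ⟶ Y :=
  pullback.fst f (specialι R)

/-- The ring homomorphism `R → Γ(Y, U)` given by the structure morphism `f : Y ⟶ S`. -/
def toSections {Y : Scheme.{u}} (f : Y ⟶ base R) (U : Y.Opens) : R →+* Γ(Y, U) :=
  ((Scheme.ΓSpecIso (CommRingCat.of R)).inv ≫ f.appLE ⊤ U le_top).hom

/-- `u : Y' ⟶ Y` is (up to isomorphism over `Y`) the Néron blowing up `Y^C ⟶ Y` of the `S`-scheme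
`f : Y ⟶ S` at the closed subscheme `i : C ⟶ Y_s` of its special fiber: with `𝓘` the ideal sheaf
of `C` in `Y`, `u` is affine and `u_* 𝒪_{Y'} = 𝒪_Y[π⁻¹𝓘]`, that is, over each affine open `U` of
`Y` it is `Spec A[π⁻¹I] ⟶ Spec A` with `A = Γ(Y, U)` and `I = 𝓘(U)`. (An isomorphism of
`A`-algebras onto `A[π⁻¹I]` is unique, so these local isomorphisms are compatible with
restriction.) -/
structure IsNeronBlowingUp {Y' Y C : Scheme.{u}} (f : Y ⟶ base R) (i : C ⟶ specialFiber f)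
    (u : Y' ⟶ Y) : Prop where
  isClosedImmersion : IsClosedImmersion i
  isAffineHom : IsAffineHom u
  isBlowupAlgebra : ∀ U : Y.affineOpens,
    IsBlowupAlgebra (toSections f U.1) ((i ≫ specialFiberι f).ker.ideal U) (u.app U.1).hom

/-- `c : Y' ⟶ Y` is a composite `Y' = Y_n ⟶ ⋯ ⟶ Y_1 ⟶ Y_0 = Y` of finitely many (`n ≥ 0`) Néron
blowing ups `Y_{j+1} ⟶ Y_j`, each at a closed subscheme of the special fiber of `Y_j`. -/
inductive IsNeronComposite :
    ∀ {Y' Y : Scheme.{u}} (_f : Y ⟶ base R) (_c : Y' ⟶ Y), Prop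
  | id {Y : Scheme.{u}} (f : Y ⟶ base R) : IsNeronComposite f (𝟙 Y)
  | comp {Y₂ Y₁ Y C : Scheme.{u}} (f : Y ⟶ base R) (i : C ⟶ specialFiber f) (u : Y₁ ⟶ Y)
      (hu : IsNeronBlowingUp f i u) (c : Y₂ ⟶ Y₁) (hc : IsNeronComposite (u ≫ f) c) :
      IsNeronComposite f (c ≫ u)

end NeronBlowup

end

/-! Over an affine open of Y, h is a map of R-algebras A → B with A and B free of ϖ-torsion and
A[1/ϖ] = B[1/ϖ]. Hence A ⊆ B, and every b ∈ B has ϖ^n b ∈ A for some n. Since h is of finite type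
and Y is quasi-compact, one n serves for generators of B over every member of a finite affine cover
(`exists_powDivisionRing_eq_top`).

Let A₁ ⊆ B be generated by A and all b with ϖb ∈ A. The elements ϖb that occur form the ideal I = A
∩ ϖB, which cuts out the schematic image of Y'_s in Y_s (`mem_ker_specialImageι`). So A₁ = A[π⁻¹I],
the Néron blowing up at that image (`isNeronBlowingUp_toBase`). If ϖ^(n+1) b ∈ A, then ϖ^n b ∈ A₁:
replacing A by A₁ lowers the exponent by one (`powDivisionRing_succ_le`), and at exponent 0 one has
A = B. This is the induction in `exists_isNeronComposite`.

Globally, A ↦ A₁ commutes with localization, so the algebras A₁ glue to a relative spectrum over Y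
through which h factors. -/

noncomputable section

/-! ### Relative spectrum of a quasi-coherent system of subrings -/

namespace NeronBlowup
open Scheme

/-- A quasi-coherent system of subrings of `f_* 𝒪_X` containing the image of `𝒪_Y`. -/
structure SubringSystem {X Y : Scheme.{u}} (f : X ⟶ Y) where
  /-- The subring of sections over an open. -/
  ring : ∀ U : Y.Opens, Subring Γ(X, f ⁻¹ᵁ U)
  app_mem : ∀ (U : Y.Opens) (a : Γ(Y, U)), (f.app U).hom a ∈ ring U
  map_mem : ∀ {U V : Y.Opens} (e : U ≤ V) (b : Γ(X, f ⁻¹ᵁ V)), b ∈ ring V →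
    (X.presheaf.map (homOfLE (f.preimage_mono e)).op).hom b ∈ ring U
  exists_pow_mul_mem : ∀ (U : Y.affineOpens) (r : Γ(Y, U)) (b : Γ(X, f ⁻¹ᵁ Y.basicOpen r)),
    b ∈ ring (Y.basicOpen r) → ∃ (n : ℕ) (c : Γ(X, f ⁻¹ᵁ U.1)), c ∈ ring U ∧
      (X.presheaf.map (homOfLE (f.preimage_mono (Y.basicOpen_le r))).op).hom c =
        (X.presheaf.map (homOfLE (f.preimage_mono (Y.basicOpen_le r))).op).hom
          ((f.app U).hom r) ^ n * b

namespace SubringSystem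

variable {X Y : Scheme.{u}} {f : X ⟶ Y} (S : SubringSystem f)

/-- The restriction maps of a system of subrings. -/
def res {U V : Y.Opens} (e : U ≤ V) : S.ring V →+* S.ring U :=
  (X.presheaf.map (homOfLE (f.preimage_mono e)).op).hom.restrict _ _ (S.map_mem e)

/-- The map from sections of `𝒪_Y` to a system of subrings. -/
def ofSections (U : Y.Opens) : Γ(Y, U) →+* S.ring U :=
  (f.app U).hom.codRestrict _ (S.app_mem _)

lemma res_ofSections {U V : Y.Opens} (e : U ≤ V) (a : Γ(Y, V)) :
    S.res e (S.ofSections V a) = S.ofSections U ((Y.presheaf.map (homOfLE e).op).hom a) :=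
  Subtype.ext congr(($(f.naturality (homOfLE e).op)).hom a).symm

/-- The presheaf of rings on affine opens given by a system of subrings. -/
abbrev presheaf : Y.AffineZariskiSiteᵒᵖ ⥤ CommRingCat.{u} where
  obj U := .of (S.ring U.unop.1)
  map {U V} i := CommRingCat.ofHom (S.res (AffineZariskiSite.toOpens_mono i.unop.le))
  map_id U := by
    ext x
    change (X.presheaf.map (𝟙 _)).hom x.1 = x.1
    rw [X.presheaf.map_id]; rfl
  map_comp {U V W} i j := by
    ext x
    have e₁ := f.preimage_mono (AffineZariskiSite.toOpens_mono i.unop.le)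
    have e₂ := f.preimage_mono (AffineZariskiSite.toOpens_mono j.unop.le)
    change (X.presheaf.map ((homOfLE e₁).op ≫ (homOfLE e₂).op)).hom x.1 = _
    rw [X.presheaf.map_comp]; rfl

/-- The structure map from `𝒪_Y`. -/
abbrev structureMap :
    (AffineZariskiSite.toOpensFunctor Y).op ⋙ Y.presheaf ⟶ S.presheaf where
  app U := CommRingCat.ofHom (S.ofSections U.unop.1)
  naturality {U V} i := by
    ext x
    exact congr(($(S.res_ofSections (AffineZariskiSite.toOpens_mono i.unop.le) x)).1).symm

/-- This is quasi-coherence, the condition for the spectra to glue: the ring over D(r) is the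
localization at r of the ring over U. Fractions come from `exists_pow_mul_mem`; equality up to a
power of r is inherited from the ambient sections of 𝒪_X. -/
lemma coequifibered_structureMap [IsAffineHom f] : S.structureMap.Coequifibered := by
  refine AffineZariskiSite.coequifibered_iff_forall_isLocalizationAway.mpr fun U r ↦ ?_
  let ρ := (X.presheaf.map (homOfLE (f.preimage_mono (Y.basicOpen_le r))).op).hom
  have hloc : @IsLocalization.Away _ _ ((f.app U.1).hom r) Γ(X, f ⁻¹ᵁ Y.basicOpen r) _
      ρ.toAlgebra := by
    let : Algebra Γ(X, f ⁻¹ᵁ U.1) Γ(X, f ⁻¹ᵁ Y.basicOpen r) := ρ.toAlgebra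
    exact (U.2.preimage f).isLocalization_of_eq_basicOpen _ _ (f.preimage_basicOpen r)
  let := ρ.toAlgebra
  let := (S.res (Y.basicOpen_le r)).toAlgebra
  let s : S.ring U.1 := S.ofSections U.1 r
  change IsLocalization.Away s (S.ring (Y.basicOpen r))
  refine ⟨⟨?_, ?_, ?_⟩⟩
  · rintro ⟨_, n, rfl⟩
    rw [RingHom.map_pow]
    refine IsUnit.pow n ?_
    have hr : IsUnit ((Y.presheaf.map (homOfLE (Y.basicOpen_le r)).op).hom r) :=
      RingedSpace.isUnit_res_basicOpen _ r
    have := hr.map (S.ofSections (Y.basicOpen r))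
    rwa [← S.res_ofSections] at this
  · intro b
    obtain ⟨n, c, hc, e⟩ := S.exists_pow_mul_mem U r b.1 b.2
    refine ⟨⟨⟨c, hc⟩, ⟨s ^ n, n, rfl⟩⟩, Subtype.ext ?_⟩
    change b.1 * ρ ((f.app U.1).hom r ^ n) = ρ c
    rw [map_pow, mul_comm]
    exact e.symm
  · intro b c hbc
    obtain ⟨⟨_, n, rfl⟩, e⟩ := IsLocalization.exists_of_eq
      (M := .powers ((f.app U.1).hom r)) (x := b.1) (y := c.1) congr(($hbc).1)
    exact ⟨⟨s ^ n, n, rfl⟩, Subtype.ext e⟩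

section Glue

variable [IsAffineHom f]

/-- The gluing data of the relative spectrum of a system of subrings. -/
def glueData := AffineZariskiSite.relativeGluingData S.coequifibered_structureMap

instance : (S.glueData.functor ⋙ Scheme.forget).IsLocallyDirected :=
  Cover.RelativeGluingData.instIsLocallyDirectedI₀CompFunctorForgetOfIsThin ..

/-- The relative spectrum of a system of subrings. -/
def spec : Scheme.{u} := S.glueData.glued

/-- The affine pieces of the relative spectrum. -/
def ι (U : Y.affineOpens) : Spec (.of (S.ring U.1)) ⟶ S.spec := colimit.ι S.glueData.functor U

instance (U : Y.affineOpens) : IsOpenImmersion (S.ι U) :=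
  S.glueData.cover.map_prop U

/-- The structure morphism of the relative spectrum. -/
def toBase : S.spec ⟶ Y := S.glueData.toBase

lemma ι_toBase (U : Y.affineOpens) :
    S.ι U ≫ S.toBase = Spec.map (CommRingCat.ofHom (S.ofSections U.1)) ≫ U.2.fromSpec :=
  colimit.ι_desc _ _

lemma toBase_preimage (U : Y.affineOpens) : S.toBase ⁻¹ᵁ U = (S.ι U).opensRange := by
  have := S.glueData.toBase_preimage_eq_opensRange_ι U
  have h : ((AffineZariskiSite.directedCover Y).f U).opensRange = U.1 :=
    Scheme.Opens.opensRange_ι U.1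
  rw [h] at this
  exact this

lemma map_ι {U V : Y.AffineZariskiSite} (i : U ⟶ V) :
    Spec.map (S.presheaf.map i.op) ≫ S.ι V = S.ι U :=
  colimit.w S.glueData.functor i

instance : IsAffineHom S.toBase := by
  refine isAffineHom_of_forall_exists_isAffineOpen _ fun x ↦ ?_
  obtain ⟨U, hxU⟩ := TopologicalSpace.Opens.mem_iSup.mp
    ((iSup_affineOpens_eq_top Y).ge (Set.mem_univ x))
  exact ⟨U, hxU, U.2, S.toBase_preimage U ▸ isAffineOpen_opensRange (S.ι U)⟩

/-- The restriction to the preimage of an affine open of the morphism to the relative spectrum. -/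
def liftOn (U : Y.affineOpens) : (f ⁻¹ᵁ U.1).toScheme ⟶ S.spec :=
  (f ⁻¹ᵁ U.1).toSpecΓ ≫ Spec.map (CommRingCat.ofHom (S.ring U.1).subtype) ≫ S.ι U

lemma homOfLE_liftOn {U V : Y.AffineZariskiSite} (i : U ⟶ V) :
    X.homOfLE (f.preimage_mono (AffineZariskiSite.toOpens_mono i.1.1)) ≫ S.liftOn V =
      S.liftOn U := by
  change _ ≫ (f ⁻¹ᵁ V.1).toSpecΓ ≫ Spec.map (CommRingCat.ofHom (S.ring V.1).subtype) ≫ S.ι V =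
    (f ⁻¹ᵁ U.1).toSpecΓ ≫ Spec.map (CommRingCat.ofHom (S.ring U.1).subtype) ≫ S.ι U
  rw [← Scheme.Opens.toSpecΓ_SpecMap_presheaf_map_assoc, ← S.map_ι i,
    ← Spec.map_comp_assoc, ← Spec.map_comp_assoc]
  rfl

lemma trans_liftOn {U V : Y.AffineZariskiSite} (i : U ⟶ V) :
    Cover.trans ((AffineZariskiSite.directedCover Y).pullback₁ f) i ≫
      (pullbackRestrictIsoRestrict f V.1).hom ≫ S.liftOn V =
      (pullbackRestrictIsoRestrict f U.1).hom ≫ S.liftOn U := by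
  have h : Cover.trans ((AffineZariskiSite.directedCover Y).pullback₁ f) i ≫
      pullback.fst f V.1.ι = pullback.fst f U.1.ι := by
    refine (pullback.lift_fst _ _ _).trans (Category.comp_id _)
  have : Cover.trans ((AffineZariskiSite.directedCover Y).pullback₁ f) i ≫
      (pullbackRestrictIsoRestrict f V.1).hom = (pullbackRestrictIsoRestrict f U.1).hom ≫
      X.homOfLE (f.preimage_mono (AffineZariskiSite.toOpens_mono i.1.1)) := by
    refine (cancel_mono (f ⁻¹ᵁ V.1).ι).mp ?_
    refine (Category.assoc _ _ _).trans ?_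
    refine (congrArg (_ ≫ ·) (pullbackRestrictIsoRestrict_hom_ι f V.1)).trans (h.trans ?_)
    refine ((Category.assoc _ _ _).trans ?_).symm
    refine (congrArg (_ ≫ ·) (X.homOfLE_ι _)).trans (pullbackRestrictIsoRestrict_hom_ι f U.1)
  refine (Category.assoc _ _ _).symm.trans ?_
  refine (congrArg (· ≫ S.liftOn V) this).trans ?_
  refine (Category.assoc _ _ _).trans ?_
  exact congrArg (_ ≫ ·) (S.homOfLE_liftOn i)

/-- The canonical morphism to the relative spectrum. -/
def lift : X ⟶ S.spec :=
  Scheme.OpenCover.glueMorphismsOfLocallyDirected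
    ((AffineZariskiSite.directedCover Y).pullback₁ f)
    (fun U ↦ (pullbackRestrictIsoRestrict f _).hom ≫ S.liftOn U) S.trans_liftOn

lemma ι_lift (U : Y.affineOpens) : (f ⁻¹ᵁ U.1).ι ≫ S.lift = S.liftOn U := by
  have h : pullback.fst f U.1.ι ≫ S.lift = (pullbackRestrictIsoRestrict f U.1).hom ≫ S.liftOn U :=
    Scheme.OpenCover.map_glueMorphismsOfLocallyDirected
      ((AffineZariskiSite.directedCover Y).pullback₁ f) _ S.trans_liftOn U
  rw [← cancel_epi (pullbackRestrictIsoRestrict f U.1).hom, ← h,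
    pullbackRestrictIsoRestrict_hom_ι_assoc]

lemma liftOn_toBase (U : Y.affineOpens) : S.liftOn U ≫ S.toBase = (f ⁻¹ᵁ U.1).ι ≫ f := by
  rw [liftOn, Category.assoc, Category.assoc, S.ι_toBase, ← Spec.map_comp_assoc]
  change (f ⁻¹ᵁ U.1).toSpecΓ ≫ Spec.map (f.app _) ≫ U.2.fromSpec = (f ⁻¹ᵁ U.1).ι ≫ _
  rw [Scheme.Hom.app_eq_appLE, Scheme.Opens.toSpecΓ_SpecMap_appLE_assoc, U.2.toSpecΓ_fromSpec,
    Scheme.Hom.resLE_comp_ι]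

lemma lift_toBase : S.lift ≫ S.toBase = f := by
  refine Scheme.Cover.hom_ext (X.openCoverOfIsOpenCover _
    (.comap (iSup_affineOpens_eq_top Y) f.base.1)) _ _ fun (U : Y.affineOpens) ↦ ?_
  change (f ⁻¹ᵁ U.1).ι ≫ S.lift ≫ S.toBase = (f ⁻¹ᵁ U.1).ι ≫ f
  rw [reassoc_of% S.ι_lift U, S.liftOn_toBase]

lemma preimage_toBase_lift (U : Y.Opens) : f ⁻¹ᵁ U = S.lift ⁻¹ᵁ S.toBase ⁻¹ᵁ U := by
  rw [← Scheme.Hom.comp_preimage, lift_toBase]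

lemma top_eq_preimage_ι (U : Y.affineOpens) : ⊤ = S.ι U ⁻¹ᵁ S.toBase ⁻¹ᵁ U := by
  rw [toBase_preimage, Scheme.Hom.preimage_opensRange]

instance (U : Y.affineOpens) :
    IsIso ((S.ι U).appLE (S.toBase ⁻¹ᵁ U) ⊤ (S.top_eq_preimage_ι U).le) := by
  have : IsIso ((S.ι U).app (S.toBase ⁻¹ᵁ U)) :=
    Scheme.Hom.isIso_app _ _ (S.toBase_preimage U).le
  have : IsIso (homOfLE (S.top_eq_preimage_ι U).le) :=
    ⟨homOfLE (S.top_eq_preimage_ι U).ge, rfl, rfl⟩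
  rw [Scheme.Hom.appLE]
  infer_instance

/-- Up to canonical isomorphisms, the lift is the inclusion of the subring on sections; its
injectivity and its range are read off from this. -/
lemma appLE_lift (U : Y.affineOpens) :
    S.lift.appLE (S.toBase ⁻¹ᵁ U) (f ⁻¹ᵁ U) (S.preimage_toBase_lift U).le =
      (S.ι U).appLE (S.toBase ⁻¹ᵁ U) ⊤ (S.top_eq_preimage_ι U).le ≫
        (Scheme.ΓSpecIso _).hom ≫ CommRingCat.ofHom (S.ring U.1).subtype := by
  have key : ((f ⁻¹ᵁ U.1).ι ≫ S.lift).appLE (S.toBase ⁻¹ᵁ U) ⊤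
        (by rw [S.ι_lift U]; simp [liftOn, ← S.top_eq_preimage_ι U]) =
      (S.liftOn U).appLE (S.toBase ⁻¹ᵁ U) ⊤ (by simp [liftOn, ← S.top_eq_preimage_ι U]) := by
    simp_rw [S.ι_lift U]
  have hl := Scheme.Hom.appLE_comp_appLE (f ⁻¹ᵁ U.1).ι S.lift (S.toBase ⁻¹ᵁ U) (f ⁻¹ᵁ U) ⊤
    (S.preimage_toBase_lift U).le (by simp)
  have hr₁ := Scheme.Hom.appLE_comp_appLE (Spec.map (CommRingCat.ofHom (S.ring U.1).subtype))
    (S.ι U) (S.toBase ⁻¹ᵁ U) ⊤ ⊤ (S.top_eq_preimage_ι U).le le_top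
  have hr₂ := Scheme.Hom.appLE_comp_appLE (f ⁻¹ᵁ U.1).toSpecΓ
    (Spec.map (CommRingCat.ofHom (S.ring U.1).subtype) ≫ S.ι U) (S.toBase ⁻¹ᵁ U) ⊤ ⊤
    (by simp [← S.top_eq_preimage_ι U]) le_top
  rw [← hl] at key
  erw [← hr₂, ← hr₁] at key
  have h₁ : (f ⁻¹ᵁ U.1).ι.appLE (f ⁻¹ᵁ U.1) ⊤ (by simp) = (f ⁻¹ᵁ U.1).topIso.inv := by
    rw [Scheme.Opens.ι_appLE]; rfl
  have h₂ : (f ⁻¹ᵁ U.1).toSpecΓ.appLE ⊤ ⊤ le_top =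
      (Scheme.ΓSpecIso Γ(X, f ⁻¹ᵁ U.1)).hom ≫ (f ⁻¹ᵁ U.1).topIso.inv := by
    rw [← Scheme.Opens.toSpecΓ_appTop]; exact Scheme.Hom.appLE_eq_app _
  have h₃ : (Spec.map (CommRingCat.ofHom (S.ring U.1).subtype)).appLE ⊤ ⊤ le_top ≫
      (Scheme.ΓSpecIso Γ(X, f ⁻¹ᵁ U.1)).hom =
      (Scheme.ΓSpecIso _).hom ≫ CommRingCat.ofHom (S.ring U.1).subtype := by
    rw [← Scheme.ΓSpecIso_naturality]
    exact congrArg (· ≫ (Scheme.ΓSpecIso Γ(X, f ⁻¹ᵁ U.1)).hom) (Scheme.Hom.appLE_eq_app _)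
  rw [h₁, h₂] at key
  rw [← cancel_mono (f ⁻¹ᵁ U.1).topIso.inv, key, ← h₃]
  simp only [Category.assoc]

lemma bijective_appLE_ι (U : Y.affineOpens) : Function.Bijective
    ((S.ι U).appLE (S.toBase ⁻¹ᵁ U) ⊤ (S.top_eq_preimage_ι U).le ≫
      (Scheme.ΓSpecIso (.of (S.ring U.1))).hom).hom :=
  ConcreteCategory.bijective_of_isIso _

lemma appLE_lift_injective (U : Y.affineOpens) :
    Function.Injective
      (S.lift.appLE (S.toBase ⁻¹ᵁ U) (f ⁻¹ᵁ U) (S.preimage_toBase_lift U).le).hom := by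
  rw [appLE_lift, ← Category.assoc]
  exact Subtype.val_injective.comp (S.bijective_appLE_ι U).1

lemma range_appLE_lift (U : Y.affineOpens) :
    (S.lift.appLE (S.toBase ⁻¹ᵁ U) (f ⁻¹ᵁ U) (S.preimage_toBase_lift U).le).hom.range =
      S.ring U := by
  rw [appLE_lift, ← Category.assoc]
  ext x
  constructor
  · rintro ⟨y, rfl⟩
    exact Subtype.prop _
  · intro hx
    obtain ⟨y, hy⟩ := (S.bijective_appLE_ι U).2 ⟨x, hx⟩
    exact ⟨y, congr(($hy).1)⟩

end Glue

end SubringSystem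
end NeronBlowup

/-! ### Adjoining quotients by s, and compatibility with localization -/

namespace NeronBlowup

section Ring

variable {A B A' B' : Type*} [CommRing A] [CommRing B] [CommRing A'] [CommRing B']

/-- The subring of `B` generated by `A` and by the `b ∈ B` with `s b ∈ A`. -/
def divisionRing (θ : A →+* B) (s : A) : Subring B :=
  Subring.closure (Set.range θ ∪ {b | ∃ a, θ s * b = θ a})

lemma map_mem_divisionRing (θ : A →+* B) (s a : A) : θ a ∈ divisionRing θ s :=
  Subring.subset_closure (.inl ⟨a, rfl⟩)

lemma mem_divisionRing_of_mul_eq {θ : A →+* B} {s a : A} {b : B} (h : θ s * b = θ a) :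
    b ∈ divisionRing θ s :=
  Subring.subset_closure (.inr ⟨a, h⟩)

lemma map_divisionRing {θ : A →+* B} {θ' : A' →+* B'} {α : A →+* A'} {ρ : B →+* B'}
    (h : ∀ a, ρ (θ a) = θ' (α a)) {s : A} {b : B} (hb : b ∈ divisionRing θ s) :
    ρ b ∈ divisionRing θ' (α s) := by
  suffices divisionRing θ s ≤ (divisionRing θ' (α s)).comap ρ from this hb
  refine Subring.closure_le.mpr ?_
  rintro _ (⟨a, rfl⟩ | ⟨a, ha⟩)
  · change ρ (θ a) ∈ divisionRing θ' (α s)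
    rw [h]
    exact map_mem_divisionRing _ _ _
  · exact mem_divisionRing_of_mul_eq (a := α a) (by rw [← h, ← map_mul, ha, h])

/-- Elements whose denominators can be cleared inside the smaller ring are closed under the ring
operations, so only generators matter; there both the quotient b and its numerator s b must be
lifted. -/
lemma exists_pow_mul_mem_divisionRing {θ : A →+* B} {θ' : A' →+* B'} [Algebra A A']
    [Algebra B B'] (h : ∀ a, algebraMap B B' (θ a) = θ' (algebraMap A A' a)) (r s : A)
    [IsLocalization.Away r A'] [IsLocalization.Away (θ r) B'] {b : B'}
    (hb : b ∈ divisionRing θ' (algebraMap A A' s)) :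
    ∃ (n : ℕ) (c : B), c ∈ divisionRing θ s ∧
      algebraMap B B' c = algebraMap B B' (θ r) ^ n * b := by
  have hr : ∀ n : ℕ, θ r ^ n ∈ divisionRing θ s := fun n ↦
    pow_mem (map_mem_divisionRing _ _ _) n
  have hA (a : A') : ∃ (n : ℕ) (a₀ : A), algebraMap A A' a₀ = algebraMap A A' r ^ n * a := by
    obtain ⟨n, a₀, e⟩ := IsLocalization.Away.surj r a
    exact ⟨n, a₀, by rw [← e, mul_comm]⟩
  induction hb using Subring.closure_induction with
  | mem b hb =>
    rcases hb with ⟨a, rfl⟩ | ⟨a, ha⟩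
    · obtain ⟨n, a₀, e⟩ := hA a
      exact ⟨n, θ a₀, map_mem_divisionRing _ _ _, by rw [h, e, map_mul, map_pow, h]⟩
    · obtain ⟨m, a₀, e⟩ := hA a
      obtain ⟨n, b₀, e'⟩ := IsLocalization.Away.surj (θ r) b
      -- With a₀ = r^m a and b₀ = r^n b, the relation s b = a becomes s r^m b₀ = r^n a₀. It holds in
      -- B only after multiplication by some r^k, so the lift of b is r^(k+m) b₀, with numerator
      -- r^(k+n) a₀.
      obtain ⟨⟨_, k, rfl⟩, ek⟩ := IsLocalization.exists_of_eq (M := .powers (θ r)) (S := B')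
        (x := θ s * θ r ^ m * b₀) (y := θ r ^ n * θ a₀) (by
          simp only [map_mul, map_pow, ← e', h, e] at ha ⊢
          linear_combination θ' (algebraMap A A' r) ^ (m + n) * ha)
      refine ⟨k + m + n, θ r ^ (k + m) * b₀, mem_divisionRing_of_mul_eq
        (a := r ^ (k + n) * a₀) ?_, ?_⟩
      · simp only [map_mul, map_pow] at ek ⊢
        linear_combination ek
      · simp only [map_mul, map_pow, ← e']
        ring
  | zero => exact ⟨0, 0, zero_mem _, by simp⟩
  | one => exact ⟨0, 1, one_mem _, by simp⟩
  | add x y _ _ hx hy =>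
    obtain ⟨n, c, hc, e⟩ := hx
    obtain ⟨m, d, hd, e'⟩ := hy
    refine ⟨n + m, θ r ^ m * c + θ r ^ n * d,
      add_mem (mul_mem (hr m) hc) (mul_mem (hr n) hd), ?_⟩
    simp only [map_mul, map_pow, map_add, e, e']
    ring
  | neg x _ hx =>
    obtain ⟨n, c, hc, e⟩ := hx
    exact ⟨n, -c, neg_mem hc, by simp [e]⟩
  | mul x y _ _ hx hy =>
    obtain ⟨n, c, hc, e⟩ := hx
    obtain ⟨m, d, hd, e'⟩ := hy
    refine ⟨n + m, c * d, mul_mem hc hd, ?_⟩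
    simp only [map_mul, e, e']
    ring

end Ring

variable {R : Type u} [CommRing R]

lemma toSections_eq {Y : Scheme.{u}} (f : Y ⟶ base R) (U : Y.Opens) :
    toSections f U = (f.appLE ⊤ U le_top).hom.comp
      (Scheme.ΓSpecIso (CommRingCat.of R)).inv.hom := rfl

@[simp]
lemma map_toSections {Y : Scheme.{u}} (f : Y ⟶ base R) {U V : Y.Opens} (e : U ≤ V) (r : R) :
    (Y.presheaf.map (homOfLE e).op).hom (toSections f V r) = toSections f U r := by
  have := Scheme.Hom.appLE_map f (U := ⊤) (V := V) le_top (homOfLE e).op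
  exact congr(($this).hom ((Scheme.ΓSpecIso (CommRingCat.of R)).inv.hom r))

@[simp]
lemma appLE_toSections {Y Y' : Scheme.{u}} (f : Y ⟶ base R) (h : Y' ⟶ Y) (U : Y.Opens)
    (V : Y'.Opens) (e : V ≤ h ⁻¹ᵁ U) (r : R) :
    (h.appLE U V e).hom (toSections f U r) = toSections (h ≫ f) V r := by
  have := Scheme.Hom.appLE_comp_appLE h f ⊤ U V le_top e
  exact congr(($this).hom ((Scheme.ΓSpecIso (CommRingCat.of R)).inv.hom r))

@[simp]
lemma app_toSections {Y Y' : Scheme.{u}} (f : Y ⟶ base R) (h : Y' ⟶ Y) (U : Y.Opens) (r : R) :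
    (h.app U).hom (toSections f U r) = toSections (h ≫ f) (h ⁻¹ᵁ U) r := by
  rw [Scheme.Hom.app_eq_appLE]
  exact appLE_toSections f h U _ _ r

/-- For an affine morphism `h : Y' ⟶ Y` of `S`-schemes, the subrings of `h_* 𝒪_{Y'}` generated by
`𝒪_Y` and the sections `b` with `ϖ b ∈ 𝒪_Y`. -/
def divisionSystem {Y Y' : Scheme.{u}} (f : Y ⟶ base R) (h : Y' ⟶ Y) [IsAffineHom h] (ϖ : R) :
    SubringSystem h where
  ring U := divisionRing (h.app U).hom (toSections f U ϖ)
  app_mem U a := map_mem_divisionRing _ _ _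
  map_mem {U V} e b hb := by
    have := map_divisionRing (θ := (h.app V).hom) (θ' := (h.app U).hom)
      (α := (Y.presheaf.map (homOfLE e).op).hom)
      (ρ := (Y'.presheaf.map (homOfLE (h.preimage_mono e)).op).hom)
      (fun a ↦ congr(($(h.naturality (homOfLE e).op)).hom a).symm) hb
    rwa [map_toSections] at this
  exists_pow_mul_mem U r b hb := by
    let := (Y'.presheaf.map (homOfLE (h.preimage_mono (Y.basicOpen_le r))).op).hom.toAlgebra
    let := (Y.presheaf.map (homOfLE (Y.basicOpen_le r)).op).hom.toAlgebra
    have : IsLocalization.Away r Γ(Y, Y.basicOpen r) := U.2.isLocalization_basicOpen r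
    have : IsLocalization.Away ((h.app U.1).hom r) Γ(Y', h ⁻¹ᵁ Y.basicOpen r) :=
      (U.2.preimage h).isLocalization_of_eq_basicOpen _ _ (h.preimage_basicOpen r)
    refine exists_pow_mul_mem_divisionRing (θ := (h.app U.1).hom)
      (θ' := (h.app (Y.basicOpen r)).hom)
      (fun a ↦ congr(($(h.naturality (homOfLE (Y.basicOpen_le r)).op)).hom a).symm) r
      (toSections f U.1 ϖ) ?_
    rw [← map_toSections f (Y.basicOpen_le r)] at hb
    exact hb

end NeronBlowup

/-! ### Identification with A[π⁻¹I] -/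

namespace NeronBlowup

section Algebra

variable {R : Type u} [CommRing R] [IsDomain R] [IsDiscreteValuationRing R]

lemma isLocalization_fractionRing {ϖ : R} (hϖ : Irreducible ϖ) :
    IsLocalization.Away ϖ (FractionRing R) := by
  have h0 : algebraMap R (FractionRing R) ϖ ≠ 0 := by simpa using hϖ.ne_zero
  refine ⟨⟨?_, ?_, ?_⟩⟩
  · rintro ⟨_, n, rfl⟩
    rw [map_pow]
    exact (Ne.isUnit h0).pow n
  · intro x
    obtain ⟨a, b, hb, rfl⟩ := IsFractionRing.div_surjective (A := R) x
    obtain ⟨n, v, hv⟩ := IsDiscreteValuationRing.associated_pow_irreducible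
      (nonZeroDivisors.ne_zero hb) hϖ
    refine ⟨⟨a * v, ⟨ϖ ^ n, n, rfl⟩⟩, ?_⟩
    have hb' : algebraMap R (FractionRing R) b ≠ 0 := by simpa using nonZeroDivisors.ne_zero hb
    simp only [← hv, map_mul]
    field_simp
  · intro x y hxy
    exact ⟨1, by rw [IsFractionRing.injective R (FractionRing R) hxy]⟩

variable {A B C : Type u} [CommRing A] [CommRing B] [CommRing C] [Algebra R A]
  [Algebra A B] [Algebra A C]

/-- Both A ⊗ K and C[1/s] are localizations of A at s, the first because K = R[1/ϖ], the second by
`htors` and `hinj`. Thus B and A[π⁻¹I] embed in the same A-algebra, where their generators a/ϖ agree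
by `hI`. -/
lemma nonempty_algEquiv_blowupAlgebra {ϖ : R} (hϖ : Irreducible ϖ) {I : Ideal A}
    {ι : B →ₐ[A] C} (hι : Function.Injective ι)
    (hrange : ι.toRingHom.range = divisionRing (algebraMap A C) (algebraMap R A ϖ))
    (hinj : Function.Injective (algebraMap A C))
    (hreg : ∀ c : C, algebraMap A C (algebraMap R A ϖ) * c = 0 → c = 0)
    (htors : ∀ c : C, ∃ (n : ℕ) (a : A), algebraMap A C (algebraMap R A ϖ) ^ n * c = algebraMap A C a)
    (hI : ∀ a, a ∈ I ↔ ∃ c, algebraMap A C a = algebraMap A C (algebraMap R A ϖ) * c) :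
    Nonempty (B ≃ₐ[A] blowupAlgebra R A I) := by
  have := isLocalization_fractionRing hϖ
  set L := A ⊗[R] FractionRing R
  set s := algebraMap R A ϖ
  have hL : IsLocalization.Away s L := IsLocalization.Away.tensor ϖ _
  have hregC : ∀ (n : ℕ) (c c' : C), algebraMap A C s ^ n * c = algebraMap A C s ^ n * c' →
      c = c' := by
    intro n
    induction n with
    | zero => simp
    | succ n ih =>
      intro c c' h
      refine sub_eq_zero.mp (hreg _ (ih _ _ ?_))
      linear_combination h
  have hCloc : Function.Injective (algebraMap C (Localization.Away (algebraMap A C s))) := by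
    intro c c' h
    obtain ⟨⟨_, n, rfl⟩, e⟩ := IsLocalization.exists_of_eq (M := .powers (algebraMap A C s)) h
    exact hregC n _ _ e
  have hC : IsLocalization.Away s (Localization.Away (algebraMap A C s)) := by
    refine ⟨⟨?_, ?_, ?_⟩⟩
    · rintro ⟨_, n, rfl⟩
      rw [map_pow, IsScalarTower.algebraMap_apply A C (Localization.Away (algebraMap A C s))]
      exact (IsLocalization.Away.algebraMap_isUnit _).pow n
    · intro x
      obtain ⟨n, c, hc⟩ := IsLocalization.Away.surj (algebraMap A C s) x
      obtain ⟨m, a, ha⟩ := htors c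
      refine ⟨⟨a, ⟨s ^ (n + m), n + m, rfl⟩⟩, ?_⟩
      simp only [IsScalarTower.algebraMap_apply A C (Localization.Away _), map_pow, ← ha, map_mul,
        ← hc]
      ring
    · intro x y hxy
      rw [IsScalarTower.algebraMap_apply A C, IsScalarTower.algebraMap_apply A C] at hxy
      exact ⟨1, by rw [hinj (hCloc hxy)]⟩
  let e : Localization.Away (algebraMap A C s) ≃ₐ[A] L :=
    IsLocalization.algEquiv (.powers s) _ _
  let j : B →ₐ[A] L := e.toAlgHom.comp ((IsScalarTower.toAlgHom A C _).comp ι)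
  have hj : Function.Injective j := e.injective.comp (hCloc.comp hι)
  have hsL : IsUnit (algebraMap A L s) := IsLocalization.Away.algebraMap_isUnit s
  have hBC : ∀ b₁ b₂ : B, j b₁ = j b₂ ↔ ι b₁ = ι b₂ := fun b₁ b₂ ↦ by
    rw [hj.eq_iff, hι.eq_iff]
  have hsmul (ϖ' : R) (x : L) : ϖ' • x = algebraMap A L (algebraMap R A ϖ') * x :=
    (algebraMap_smul A ϖ' x).symm.trans (Algebra.smul_def (algebraMap R A ϖ') x)
  have htmul (a : A) : a ⊗ₜ[R] (1 : FractionRing R) = algebraMap A L a := rfl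
  suffices h : j.range = blowupAlgebra R A I from
    ⟨(AlgEquiv.ofInjective j hj).trans (Subalgebra.equivOfEq _ _ h)⟩
  apply le_antisymm
  · suffices h : ∀ c ∈ divisionRing (algebraMap A C) s, ∀ b, ι b = c → j b ∈ blowupAlgebra R A I by
      rintro _ ⟨b, rfl⟩
      exact h (ι b) (hrange ▸ ⟨b, rfl⟩) b rfl
    intro c hc
    -- Closure induction needs preimages of the two operands, hence the existential form;
    -- injectivity makes it equivalent to the universal one.
    suffices h : ∃ b, ι b = c ∧ j b ∈ blowupAlgebra R A I by
      obtain ⟨b, rfl, hb⟩ := h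
      intro b' hb'
      rwa [(hBC _ _).mpr hb']
    induction hc using Subring.closure_induction with
    | mem c hc =>
      rcases hc with ⟨a, rfl⟩ | ⟨a, ha⟩
      · exact ⟨algebraMap A B a, ι.commutes a, by
          rw [j.commutes]; exact Subalgebra.algebraMap_mem _ _⟩
      · obtain ⟨b, rfl⟩ : c ∈ ι.toRingHom.range := by
          rw [hrange]; exact mem_divisionRing_of_mul_eq ha
        refine ⟨b, rfl, Algebra.subset_adjoin ⟨ϖ, hϖ, a, (hI a).mpr ⟨_, ha.symm⟩, ?_⟩⟩
        rw [hsmul, htmul, ← j.commutes, ← j.commutes, ← map_mul, hBC, map_mul, ι.commutes,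
          ι.commutes]
        exact ha
    | zero => exact ⟨0, map_zero _, by simp⟩
    | one => exact ⟨1, map_one _, by simp⟩
    | add x y _ _ hx hy =>
      obtain ⟨b, rfl, hb⟩ := hx
      obtain ⟨b', rfl, hb'⟩ := hy
      exact ⟨b + b', map_add _ _ _, by rw [map_add]; exact add_mem hb hb'⟩
    | neg x _ hx =>
      obtain ⟨b, rfl, hb⟩ := hx
      exact ⟨-b, map_neg _ _, by rw [map_neg]; exact neg_mem hb⟩
    | mul x y _ _ hx hy =>
      obtain ⟨b, rfl, hb⟩ := hx
      obtain ⟨b', rfl, hb'⟩ := hy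
      exact ⟨b * b', map_mul _ _ _, by rw [map_mul]; exact mul_mem hb hb'⟩
  · refine Algebra.adjoin_le ?_
    rintro x ⟨ϖ', hϖ', a, ha, hx⟩
    -- Another uniformizer is ϖv with v a unit, so its quotient is v⁻¹ times the quotient by ϖ.
    obtain ⟨v, rfl⟩ := IsDiscreteValuationRing.associated_of_irreducible R hϖ hϖ'
    obtain ⟨c, hc⟩ := (hI a).mp ha
    obtain ⟨b, rfl⟩ : c ∈ ι.toRingHom.range := by
      rw [hrange]; exact mem_divisionRing_of_mul_eq hc.symm
    have hb : algebraMap A L s * j b = algebraMap A L a := by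
      rw [← j.commutes, ← j.commutes, ← map_mul, hBC, map_mul, ι.commutes, ι.commutes]
      exact hc.symm
    rw [hsmul, htmul, ← hb, map_mul, map_mul, mul_assoc] at hx
    have hx' := hsL.mul_left_cancel hx
    refine ⟨algebraMap A B (algebraMap R A ↑v⁻¹) * b, ?_⟩
    change j _ = x
    rw [map_mul, j.commutes, ← hx', ← mul_assoc, ← map_mul, ← map_mul, Units.inv_mul,
      map_one, map_one, one_mul]

end Algebra

end NeronBlowup

/-! ### Ideals of the special fiber and of the schematic image -/

namespace NeronBlowup

variable {R : Type u} [CommRing R]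

lemma fromSpec_comp_eq {Y : Scheme.{u}} (f : Y ⟶ base R) {V : Y.Opens} (hV : IsAffineOpen V) :
    hV.fromSpec ≫ f = Spec.map (CommRingCat.ofHom (toSections f V)) := by
  rw [← IsAffineOpen.SpecMap_appLE_fromSpec f (isAffineOpen_top _) hV le_top,
    IsAffineOpen.fromSpec_top, Scheme.isoSpec_Spec_inv, ← Spec.map_comp]
  rfl

lemma toSections_SpecMap {T : Type u} [CommRing T] (φ : R →+* T) (r : R) :
    toSections (Spec.map (CommRingCat.ofHom φ)) ⊤ r =
      (Scheme.ΓSpecIso (CommRingCat.of T)).inv.hom (φ r) := by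
  have := Scheme.ΓSpecIso_inv_naturality (CommRingCat.ofHom φ)
  refine Eq.trans ?_ congr(($this).hom r).symm
  exact congr(($(Scheme.Hom.appLE_eq_app (Spec.map (CommRingCat.ofHom φ)) (U := ⊤))).hom
    ((Scheme.ΓSpecIso (CommRingCat.of R)).inv.hom r))

/-- On sections over V, the morphism Spec T → Spec Γ(Y, V) → Y is φ up to canonical isomorphism, so
its kernel can be tested on φ. -/
lemma eq_zero_of_app_SpecMap_fromSpec {Y : Scheme.{u}} {V : Y.Opens} (hV : IsAffineOpen V)
    {T : Type u} [CommRing T] (φ : Γ(Y, V) →+* T) {a : Γ(Y, V)}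
    (ha : ((Spec.map (CommRingCat.ofHom φ) ≫ hV.fromSpec).app V).hom a = 0) : φ a = 0 := by
  have hV' : ⊤ ≤ hV.fromSpec ⁻¹ᵁ V := hV.fromSpec_preimage_self.ge
  have h₁ : hV.fromSpec.appLE V ⊤ hV' = (Scheme.ΓSpecIso Γ(Y, V)).inv := by
    rw [Scheme.Hom.appLE, hV.fromSpec_app_self, Category.assoc, ← Functor.map_comp]
    exact (congrArg (_ ≫ ·) ((Spec Γ(Y, V)).presheaf.map_id _)).trans (Category.comp_id _)
  have h₂ := Scheme.Hom.appLE_comp_appLE (Spec.map (CommRingCat.ofHom φ)) hV.fromSpec V ⊤ ⊤ hV'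
    le_top
  have h₃ : (Spec.map (CommRingCat.ofHom φ)).appLE ⊤ ⊤ le_top =
    (Spec.map (CommRingCat.ofHom φ)).appTop := Scheme.Hom.appLE_eq_app _
  rw [h₁, h₃] at h₂
  have h₄ := (Scheme.ΓSpecIso_inv_naturality (CommRingCat.ofHom φ)).trans h₂
  have h₅ : (Scheme.ΓSpecIso (.of T)).inv.hom (φ a) = 0 := by
    refine congr(($h₄).hom a).trans ?_
    rw [Scheme.Hom.appLE, CommRingCat.hom_comp, RingHom.comp_apply, ha, map_zero]
  have hinj : Function.Injective (Scheme.ΓSpecIso (CommRingCat.of T)).inv.hom :=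
    (ConcreteCategory.bijective_of_isIso (Scheme.ΓSpecIso (CommRingCat.of T)).inv).1
  exact hinj (h₅.trans (map_zero _).symm)

variable [IsDomain R] [IsDiscreteValuationRing R]

instance : IsClosedImmersion (specialι R) :=
  IsClosedImmersion.spec_of_surjective _ IsLocalRing.residue_surjective

instance {Y : Scheme.{u}} (f : Y ⟶ base R) : IsClosedImmersion (specialFiberι f) :=
  inferInstanceAs (IsClosedImmersion (pullback.fst f (specialι R)))

/-- The maximal ideal of R is (ϖ), so Spec of Γ(Y, V)/(ϖ) lies over the special point and factors
through Y_s; this bounds the ideal of Y_s by (ϖ). Conversely ϖ vanishes on Y_s. -/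
lemma specialFiberι_ker_ideal {Y : Scheme.{u}} (f : Y ⟶ base R) {ϖ : R} (hϖ : Irreducible ϖ)
    (V : Y.affineOpens) :
    (specialFiberι f).ker.ideal V = Ideal.span {toSections f V.1 ϖ} := by
  have hV : IsAffineOpen V.1 := V.2
  apply le_antisymm
  · let J := Ideal.span {toSections f V.1 ϖ}
    let q : Spec (.of (Γ(Y, V.1) ⧸ J)) ⟶ Y :=
      Spec.map (CommRingCat.ofHom (Ideal.Quotient.mk J)) ≫ hV.fromSpec
    let σ : IsLocalRing.ResidueField R →+* Γ(Y, V.1) ⧸ J :=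
      Ideal.Quotient.lift _ ((Ideal.Quotient.mk J).comp (toSections f V.1)) fun a ha ↦ by
        rw [(IsDiscreteValuationRing.irreducible_iff_uniformizer ϖ).mp hϖ,
          Ideal.mem_span_singleton] at ha
        obtain ⟨b, rfl⟩ := ha
        rw [RingHom.comp_apply, Ideal.Quotient.eq_zero_iff_mem, map_mul]
        exact Ideal.mul_mem_right _ _ (Ideal.mem_span_singleton_self _)
    have hq : q ≫ f = Spec.map (CommRingCat.ofHom σ) ≫ specialι R := by
      rw [Category.assoc, fromSpec_comp_eq, ← Spec.map_comp, ← Spec.map_comp]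
      rfl
    let l : Spec (.of (Γ(Y, V.1) ⧸ J)) ⟶ specialFiber f := pullback.lift q _ hq
    have hl : l ≫ specialFiberι f = q := pullback.lift_fst _ _ _
    refine (Scheme.Hom.le_ker_comp l (specialFiberι f) V).trans ?_
    rw [hl]
    intro a ha
    exact Ideal.Quotient.eq_zero_iff_mem.mp
      (eq_zero_of_app_SpecMap_fromSpec hV _ (Scheme.Hom.ideal_ker_le q V ha))
  · rw [Ideal.span_singleton_le_iff_mem, Scheme.Hom.ker_apply, RingHom.mem_ker]
    refine (app_toSections f (specialFiberι f) V.1 ϖ).trans ?_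
    have hcond : specialFiberι f ≫ f = pullback.snd f (specialι R) ≫ specialι R :=
      pullback.condition
    rw [hcond, ← appLE_toSections (specialι R) _ ⊤ _ le_top, toSections_SpecMap,
      (IsLocalRing.residue_eq_zero_iff _).mpr, map_zero, map_zero]
    exact (IsLocalRing.mem_maximalIdeal _).mpr hϖ.not_isUnit

/-- The closed subscheme of the special fiber of `Y` that is the schematic image of the special
fiber of `Y'`. -/
abbrev specialImageι {Y Y' : Scheme.{u}} (f : Y ⟶ base R) (h : Y' ⟶ Y) :
    (pullback.map (h ≫ f) (specialι R) f (specialι R) h (𝟙 _) (𝟙 _)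
      (by simp) (by simp) : specialFiber (h ≫ f) ⟶ specialFiber f).image ⟶ specialFiber f :=
  Scheme.Hom.imageι _

/-- The image has the same kernel in 𝒪_Y as the composite Y'_s → Y' → Y. As h is affine, that kernel
is the preimage of the ideal of Y'_s, which is (ϖ). -/
lemma mem_ker_specialImageι {Y Y' : Scheme.{u}} (f : Y ⟶ base R) (h : Y' ⟶ Y) [IsAffineHom h]
    {ϖ : R} (hϖ : Irreducible ϖ) (U : Y.affineOpens) (a : Γ(Y, U.1)) :
    a ∈ (specialImageι f h ≫ specialFiberι f).ker.ideal U ↔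
      ∃ b, (h.app U.1).hom a = (h.app U.1).hom (toSections f U.1 ϖ) * b := by
  have : (specialImageι f h ≫ specialFiberι f).ker = (specialFiberι (h ≫ f)).ker.map h := by
    rw [Scheme.Hom.ker_comp, Scheme.IdealSheafData.ker_subschemeι, ← Scheme.Hom.ker_comp,
      ← Scheme.Hom.ker_comp]
    congr 1
    exact pullback.lift_fst _ _ _
  rw [this, Scheme.IdealSheafData.ideal_map_of_isAffineHom, Ideal.mem_comap,
    specialFiberι_ker_ideal _ hϖ, Ideal.mem_span_singleton, app_toSections]
  rfl

end NeronBlowup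

/-! ### The locus where ϖ is invertible, and ϖ-torsion -/

namespace NeronBlowup

/-- Since U → Y factors through j, the restriction of h to U is a base change of the isomorphism q.
-/
lemma isIso_morphismRestrict_of_isPullback {X Y T T' : Scheme.{u}} {h : X ⟶ Y} {j : T ⟶ Y}
    {j' : T' ⟶ X} {q : T' ⟶ T} (H : IsPullback j' q h j) [IsIso q] {U : Y.Opens}
    (g : U.toScheme ⟶ T) (hg : g ≫ j = U.ι) : IsIso (h ∣_ U) := by
  have s := (isPullback_morphismRestrict h U).flip
  rw [← hg] at s
  exact MorphismProperty.of_isPullback (P := .isomorphisms Scheme) (IsPullback.of_right' s H) ‹_›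

lemma isIso_morphismRestrict_of_le {X Y : Scheme.{u}} {h : X ⟶ Y} {U V : Y.Opens} (e : U ≤ V)
    [IsIso (h ∣_ V)] : IsIso (h ∣_ U) :=
  isIso_morphismRestrict_of_isPullback (isPullback_morphismRestrict h V).flip
    (Y.homOfLE e) (Y.homOfLE_ι e)

lemma isIso_of_forall_isIso_app {X Y : Scheme.{u}} {h : X ⟶ Y} [IsAffineHom h] {ι : Type*}
    (U : ι → Y.affineOpens) (hU : ⨆ i, (U i).1 = ⊤) (H : ∀ i, IsIso (h.app (U i).1)) :
    IsIso h :=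
  IsZariskiLocalAtTarget.of_iSup_eq_top (P := .isomorphisms Scheme) _ hU fun i ↦
    (isIso_morphismRestrict_iff_isIso_app h (U i).2).mpr (H i)

lemma isIso_morphismRestrict_of_forall_isIso_app {X Y : Scheme.{u}} {h : X ⟶ Y} [IsAffineHom h]
    {W : Y.Opens} (H : ∀ U : Y.affineOpens, U.1 ≤ W → IsIso (h.app U.1)) :
    IsIso (h ∣_ W) := by
  refine IsZariskiLocalAtTarget.of_iSup_eq_top (P := .isomorphisms Scheme) _
    (iSup_affineOpens_eq_top W) fun V ↦ ?_
  have hV : IsAffineOpen (W.ι ''ᵁ V.1) := V.2.image_of_isOpenImmersion _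
  refine (MorphismProperty.arrow_mk_iso_iff (.isomorphisms Scheme)
    (morphismRestrictRestrict h W V.1)).mpr ?_
  exact (isIso_morphismRestrict_iff_isIso_app h hV).mpr (H ⟨_, hV⟩ (W.ι_image_le V.1))

variable {R : Type u} [CommRing R]

/-- The open subscheme of an `S`-scheme where an element of `R` is invertible. -/
def invertOpen {Y : Scheme.{u}} (f : Y ⟶ base R) (r : R) : Y.Opens :=
  Y.basicOpen (toSections f ⊤ r)

lemma preimage_invertOpen {Y Y' : Scheme.{u}} (f : Y ⟶ base R) (h : Y' ⟶ Y) (r : R) :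
    h ⁻¹ᵁ invertOpen f r = invertOpen (h ≫ f) r := by
  rw [invertOpen, Scheme.preimage_basicOpen]
  exact congrArg Y'.basicOpen (app_toSections f h ⊤ r)

lemma basicOpen_toSections {Y : Scheme.{u}} (f : Y ⟶ base R) (V : Y.Opens) (r : R) :
    Y.basicOpen (toSections f V r) = V ⊓ invertOpen f r := by
  rw [← map_toSections f le_top, invertOpen]
  exact Scheme.basicOpen_res _ _ _

lemma isUnit_toSections {Y : Scheme.{u}} (f : Y ⟶ base R) {V : Y.Opens} {r : R}
    (h : V ≤ invertOpen f r) : IsUnit (toSections f V r) := by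
  have := (RingedSpace.isUnit_res_basicOpen Y.toRingedSpace (toSections f ⊤ r)).map
    (Y.presheaf.map (homOfLE h).op).hom
  rw [← map_toSections f h]
  exact (map_toSections f (Y.basicOpen_le (toSections f ⊤ r)) r) ▸ this

/-- After inverting ϖ the map on sections is bijective; n clears the denominator of the preimage of
b, and m turns the resulting equality of fractions into one over U. -/
lemma exists_pow_mul_eq_app {Y Y' : Scheme.{u}} (f : Y ⟶ base R) (h : Y' ⟶ Y) [IsAffineHom h]
    {ϖ : R} [IsIso (h ∣_ invertOpen f ϖ)] (U : Y.affineOpens)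
    (b : Γ(Y', h ⁻¹ᵁ U.1)) :
    ∃ (n : ℕ) (a : Γ(Y, U.1)),
      (h.app U.1).hom (toSections f U.1 ϖ) ^ n * b = (h.app U.1).hom a := by
  set t := toSections f U.1 ϖ
  have hD : IsAffineOpen (Y.basicOpen t) := U.2.basicOpen t
  have hle : Y.basicOpen t ≤ invertOpen f ϖ := basicOpen_toSections f U.1 ϖ ▸ inf_le_right
  have := isIso_morphismRestrict_of_le (h := h) hle
  have hiso := (isIso_morphismRestrict_iff_isIso_app h hD).mp this
  have hbij := ConcreteCategory.bijective_of_isIso (h.app (Y.basicOpen t))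
  let ρ := (Y'.presheaf.map (homOfLE (h.preimage_mono (Y.basicOpen_le t))).op).hom
  let α := (Y.presheaf.map (homOfLE (Y.basicOpen_le t)).op).hom
  have hnat (a) : ρ ((h.app U.1).hom a) = (h.app (Y.basicOpen t)).hom (α a) :=
    congr(($(h.naturality (homOfLE (Y.basicOpen_le t)).op)).hom a).symm
  let := ρ.toAlgebra
  let := α.toAlgebra
  have : IsLocalization.Away t Γ(Y, Y.basicOpen t) := U.2.isLocalization_basicOpen t
  have : IsLocalization.Away ((h.app U.1).hom t) Γ(Y', h ⁻¹ᵁ Y.basicOpen t) :=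
    (U.2.preimage h).isLocalization_of_eq_basicOpen _ _ (h.preimage_basicOpen t)
  obtain ⟨a', ha'⟩ := hbij.2 (ρ b)
  obtain ⟨n, a, ha⟩ := IsLocalization.Away.surj t a'
  obtain ⟨⟨_, m, rfl⟩, e⟩ := IsLocalization.exists_of_eq (M := .powers ((h.app U.1).hom t))
    (S := Γ(Y', h ⁻¹ᵁ Y.basicOpen t)) (x := (h.app U.1).hom t ^ n * b) (y := (h.app U.1).hom a) (by
      change ρ _ = ρ _
      change a' * α t ^ n = α a at ha
      change (h.app (Y.basicOpen t)).hom a' = ρ b at ha'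
      rw [hnat, ← ha, map_mul, map_pow, map_mul, map_pow, hnat, ha', mul_comm])
  exact ⟨m + n, t ^ m * a, by rw [map_mul, map_pow, pow_add, mul_assoc]; exact e⟩

variable [IsDomain R]

lemma eq_zero_of_toSections_mul {Y : Scheme.{u}} (f : Y ⟶ base R) [Flat f] {V : Y.Opens}
    (hV : IsAffineOpen V) {ϖ : R} (hϖ : ϖ ≠ 0) {b : Γ(Y, V)} (h : toSections f V ϖ * b = 0) :
    b = 0 := by
  have hf : (toSections f V).Flat :=
    .comp (.of_bijective (ConcreteCategory.bijective_of_isIso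
      (Scheme.ΓSpecIso (CommRingCat.of R)).inv)) (f.flat_appLE (isAffineOpen_top _) hV le_top)
  let := (toSections f V).toAlgebra
  have : Module.Flat R Γ(Y, V) := hf
  exact (IsSMulRegular.of_flat (S := Γ(Y, V)) (x := ϖ)
    (fun a b hab ↦ mul_left_cancel₀ hϖ hab)) (h.trans (mul_zero _).symm)

/-- An element of the kernel dies after inverting ϖ, so it is ϖ-power torsion, hence zero by
flatness. -/
lemma app_injective_of_flat {Y Y' : Scheme.{u}} (f : Y ⟶ base R) (h : Y' ⟶ Y) [IsAffineHom h]
    [Flat f] {ϖ : R} (hϖ : ϖ ≠ 0) [IsIso (h ∣_ invertOpen f ϖ)] (U : Y.affineOpens) :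
    Function.Injective (h.app U.1).hom := by
  set t := toSections f U.1 ϖ
  have hD : IsAffineOpen (Y.basicOpen t) := U.2.basicOpen t
  have hle : Y.basicOpen t ≤ invertOpen f ϖ := basicOpen_toSections f U.1 ϖ ▸ inf_le_right
  have := isIso_morphismRestrict_of_le (h := h) hle
  have hiso := (isIso_morphismRestrict_iff_isIso_app h hD).mp this
  have hbij := ConcreteCategory.bijective_of_isIso (h.app (Y.basicOpen t))
  refine (injective_iff_map_eq_zero _).mpr fun a ha ↦ ?_
  let α := (Y.presheaf.map (homOfLE (Y.basicOpen_le t)).op).hom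
  have hα : α a = 0 := by
    refine hbij.1 (Eq.trans ?_ (map_zero (h.app (Y.basicOpen t)).hom).symm)
    refine congr(($(h.naturality (homOfLE (Y.basicOpen_le t)).op)).hom a).trans ?_
    change (Y'.presheaf.map _).hom ((h.app U.1).hom a) = 0
    rw [ha, map_zero]
  let := α.toAlgebra
  have : IsLocalization.Away t Γ(Y, Y.basicOpen t) := U.2.isLocalization_basicOpen t
  obtain ⟨⟨_, n, rfl⟩, e⟩ := (IsLocalization.map_eq_zero_iff (.powers t) _ a).mp hα
  change t ^ n * a = 0 at e
  induction n with
  | zero => simpa using e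
  | succ n ih =>
    exact ih (eq_zero_of_toSections_mul f U.2 hϖ (by rw [← mul_assoc, ← pow_succ']; exact e))

variable [IsDiscreteValuationRing R]

lemma invertOpen_le_range {Y : Scheme.{u}} (f : Y ⟶ base R) {ϖ : R} (hϖ : Irreducible ϖ) :
    (invertOpen f ϖ : Set Y) ⊆ Set.range (pullback.fst f (genericι R)) := by
  have := isLocalization_fractionRing hϖ
  rw [Scheme.Pullback.range_fst]
  intro x hx
  rw [invertOpen, toSections_eq, RingHom.comp_apply] at hx
  replace hx := (Scheme.basicOpen_appLE f ⊤ ⊤ le_top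
    ((Scheme.ΓSpecIso (CommRingCat.of R)).inv ϖ)).le hx
  have h : f x ∈ PrimeSpectrum.basicOpen ϖ := basicOpen_eq_of_affine (R := .of R) ϖ ▸ hx.2
  exact (PrimeSpectrum.localization_away_comap_range (FractionRing R) ϖ).ge h

/-- Since K = R[1/ϖ], the generic fiber is an open subscheme of Y containing the locus where ϖ is
invertible, and the generic fiber map is the base change of h to it. -/
lemma isIso_of_isModelMap {Y Y' : Scheme.{u}} {f : Y ⟶ base R} {h : Y' ⟶ Y} (H : IsModelMap f h)
    {ϖ : R} (hϖ : Irreducible ϖ) : IsIso (h ∣_ invertOpen f ϖ) := by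
  have := isLocalization_fractionRing hϖ
  have : IsOpenImmersion (genericι R) := IsOpenImmersion.of_isLocalization ϖ
  have : IsOpenImmersion (pullback.fst f (genericι R)) := inferInstance
  have : IsIso (genericFiberMap f h) := H
  have hp : IsPullback (pullback.fst (h ≫ f) (genericι R)) (genericFiberMap f h) h
      (pullback.fst f (genericι R)) := by
    have hs : IsPullback (pullback.fst (h ≫ f) (genericι R))
        (genericFiberMap f h ≫ pullback.snd f (genericι R)) (h ≫ f) (genericι R) := by
      rw [show genericFiberMap f h ≫ pullback.snd f (genericι R) =
        pullback.snd (h ≫ f) (genericι R) from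
          (pullback.lift_snd _ _ _).trans (Category.comp_id _)]
      exact IsPullback.of_hasPullback _ _
    exact .of_bot hs (pullback.lift_fst _ _ _).symm (IsPullback.of_hasPullback f (genericι R))
  refine isIso_morphismRestrict_of_isPullback hp (IsOpenImmersion.lift _ (invertOpen f ϖ).ι ?_)
    (IsOpenImmersion.lift_fac _ _ _)
  simpa using invertOpen_le_range f hϖ

end NeronBlowup

/-! ### A single blowing up and the induction on the exponent -/

namespace NeronBlowup

lemma app_injective_of_appLE {X Y : Scheme.{u}} {h : X ⟶ Y} {U : Y.Opens} {V : X.Opens}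
    {e : V ≤ h ⁻¹ᵁ U} (H : Function.Injective (h.appLE U V e).hom) :
    Function.Injective (h.app U).hom := by
  rw [Scheme.Hom.appLE, CommRingCat.hom_comp, RingHom.coe_comp] at H
  exact H.of_comp

lemma ker_eq_bot_of_app_injective {X Y : Scheme.{u}} {h : X ⟶ Y} [QuasiCompact h] {ι : Type*}
    (U : ι → Y.affineOpens) (hU : ⨆ i, (U i).1 = ⊤)
    (H : ∀ i, Function.Injective (h.app (U i).1).hom) : h.ker = ⊥ :=
  Scheme.IdealSheafData.ext_of_iSup_eq_top U hU fun i ↦ by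
    rw [Scheme.Hom.ker_apply, (RingHom.injective_iff_ker_eq_bot _).mp (H i)]
    rfl

lemma app_injective_of_ker_eq_bot {X Y : Scheme.{u}} {h : X ⟶ Y} [QuasiCompact h]
    (H : h.ker = ⊥) (U : Y.affineOpens) : Function.Injective (h.app U.1).hom := by
  rw [RingHom.injective_iff_ker_eq_bot, ← Scheme.Hom.ker_apply, H]
  rfl

/-- The subring generated by `A` and the elements `b` with `s ^ n * b ∈ A`. -/
def powDivisionRing {A B : Type*} [CommRing A] [CommRing B] (θ : A →+* B) (s : A) (n : ℕ) :
    Subring B :=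
  Subring.closure (Set.range θ ∪ {b | ∃ a, θ s ^ n * b = θ a})

lemma powDivisionRing_zero {A B : Type*} [CommRing A] [CommRing B] (θ : A →+* B) (s : A) :
    powDivisionRing θ s 0 = θ.range := by
  refine le_antisymm (Subring.closure_le.mpr ?_) ?_
  · rintro _ (⟨a, rfl⟩ | ⟨a, ha⟩)
    · exact ⟨a, rfl⟩
    · exact ⟨a, by simpa using ha.symm⟩
  · rintro _ ⟨a, rfl⟩
    exact Subring.subset_closure (.inl ⟨a, rfl⟩)

/-- The descent: if s^(n+1) b ∈ A, then s · (s^n b) ∈ A, so s^n b is one of the elements adjoined to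
form A₁. -/
lemma powDivisionRing_succ_le {A A₁ B : Type*} [CommRing A] [CommRing A₁] [CommRing B]
    {θ : A →+* B} {θ₁ : A₁ →+* B} {ψ : A →+* A₁} (h : ∀ a, θ₁ (ψ a) = θ a) {s : A}
    (hθ₁ : θ₁.range = divisionRing θ s) (n : ℕ) :
    powDivisionRing θ s (n + 1) ≤ powDivisionRing θ₁ (ψ s) n := by
  refine Subring.closure_le.mpr ?_
  rintro b (⟨a, rfl⟩ | ⟨a, ha⟩)
  · exact Subring.subset_closure (.inl ⟨ψ a, h a⟩)
  · obtain ⟨a₁, ha₁⟩ : θ s ^ n * b ∈ θ₁.range := by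
      rw [hθ₁]
      exact mem_divisionRing_of_mul_eq (a := a) (by rw [← ha]; ring)
    exact Subring.subset_closure (.inr ⟨a₁, by rw [h, ha₁]⟩)

lemma divisionRing_eq_range_of_isUnit {A B : Type*} [CommRing A] [CommRing B] (θ : A →+* B)
    {s : A} (hs : IsUnit s) : divisionRing θ s = θ.range := by
  refine le_antisymm (Subring.closure_le.mpr ?_) ?_
  · rintro b (⟨a, rfl⟩ | ⟨a, ha⟩)
    · exact ⟨a, rfl⟩
    · obtain ⟨v, rfl⟩ := hs
      refine ⟨↑v⁻¹ * a, ?_⟩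
      rw [map_mul, ← ha, ← mul_assoc, ← map_mul, Units.inv_mul, map_one, one_mul]
  · rintro _ ⟨a, rfl⟩
    exact map_mem_divisionRing _ _ _

section

variable {R : Type u} [CommRing R] {Y Y' : Scheme.{u}} (f : Y ⟶ base R) (h : Y' ⟶ Y)
  [IsAffineHom h] (ϖ : R)

instance : IsAffineHom (divisionSystem f h ϖ).lift :=
  have : IsAffineHom ((divisionSystem f h ϖ).lift ≫ (divisionSystem f h ϖ).toBase) := by
    rwa [SubringSystem.lift_toBase]
  .of_comp _ (divisionSystem f h ϖ).toBase

lemma appLE_lift_app_toBase (U : Y.affineOpens) (a : Γ(Y, U.1)) :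
    ((divisionSystem f h ϖ).lift.appLE _ _
      ((divisionSystem f h ϖ).preimage_toBase_lift U.1).le).hom
        (((divisionSystem f h ϖ).toBase.app U.1).hom a) = (h.app U.1).hom a := by
  set S := divisionSystem f h ϖ
  have h₁ := Scheme.Hom.comp_appLE S.lift S.toBase U.1 (h ⁻¹ᵁ U.1)
    (S.preimage_toBase_lift U.1).le
  simp_rw [SubringSystem.lift_toBase, Scheme.Hom.appLE_eq_app] at h₁
  exact congr(($h₁).hom a).symm

lemma preimage_iSup_affineOpens {X : Scheme.{u}} (u : X ⟶ Y) {ι : Type*} {U : ι → Y.Opens}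
    (hU : ⨆ i, U i = ⊤) : ⨆ i, u ⁻¹ᵁ U i = ⊤ := by
  rw [← Scheme.Hom.preimage_iSup, hU]; rfl

lemma ker_lift : (divisionSystem f h ϖ).lift.ker = ⊥ :=
  ker_eq_bot_of_app_injective
    (fun U : Y.affineOpens ↦ ⟨_, U.2.preimage (divisionSystem f h ϖ).toBase⟩)
    (preimage_iSup_affineOpens _ (iSup_affineOpens_eq_top Y))
    fun U ↦ app_injective_of_appLE ((divisionSystem f h ϖ).appLE_lift_injective U)

variable {f h ϖ}

/-- Where ϖ is a unit, dividing by it adds nothing to the image of 𝒪_Y, so the blowing up changes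
nothing there. -/
lemma isIso_toBase_restrict (hker : h.ker = ⊥) :
    IsIso ((divisionSystem f h ϖ).toBase ∣_ invertOpen f ϖ) := by
  refine isIso_morphismRestrict_of_forall_isIso_app fun U hU ↦ ?_
  have hinj := app_injective_of_ker_eq_bot hker U
  refine (ConcreteCategory.isIso_iff_bijective _).mpr ⟨fun a b hab ↦ hinj ?_, fun y ↦ ?_⟩
  · rw [← appLE_lift_app_toBase f h ϖ, ← appLE_lift_app_toBase f h ϖ]
    exact congrArg _ hab
  · have hr := (divisionSystem f h ϖ).range_appLE_lift U
    have hr' : (divisionSystem f h ϖ).ring U.1 = (h.app U.1).hom.range :=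
      divisionRing_eq_range_of_isUnit _ (isUnit_toSections f hU)
    obtain ⟨a, ha⟩ := (hr.trans hr').le ⟨y, rfl⟩
    refine ⟨a, (divisionSystem f h ϖ).appLE_lift_injective U ?_⟩
    rw [← ha]
    exact appLE_lift_app_toBase f h ϖ U a

lemma isIso_lift_restrict (hker : h.ker = ⊥) [hiso : IsIso (h ∣_ invertOpen f ϖ)] :
    IsIso ((divisionSystem f h ϖ).lift ∣_
      invertOpen ((divisionSystem f h ϖ).toBase ≫ f) ϖ) := by
  have := isIso_toBase_restrict (f := f) (ϖ := ϖ) hker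
  rw [← preimage_invertOpen]
  have hc : IsIso (((divisionSystem f h ϖ).lift ≫ (divisionSystem f h ϖ).toBase) ∣_
      invertOpen f ϖ) := by rwa [SubringSystem.lift_toBase]
  rw [morphismRestrict_comp] at hc
  exact (isIso_comp_right_iff _ ((divisionSystem f h ϖ).toBase ∣_ invertOpen f ϖ)).mp hc

variable [IsDomain R] [IsDiscreteValuationRing R]

lemma isNeronBlowingUp_toBase (hϖ : Irreducible ϖ) [Flat (h ≫ f)] (hker : h.ker = ⊥)
    [IsIso (h ∣_ invertOpen f ϖ)] :
    IsNeronBlowingUp f (specialImageι f h) (divisionSystem f h ϖ).toBase where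
  isClosedImmersion := inferInstance
  isAffineHom := inferInstance
  isBlowupAlgebra U := by
    let := (toSections f U.1).toAlgebra
    let := ((divisionSystem f h ϖ).toBase.app U.1).hom.toAlgebra
    let := (h.app U.1).hom.toAlgebra
    let ι : Γ((divisionSystem f h ϖ).spec, (divisionSystem f h ϖ).toBase ⁻¹ᵁ U.1) →ₐ[Γ(Y, U.1)]
        Γ(Y', h ⁻¹ᵁ U.1) :=
      { ((divisionSystem f h ϖ).lift.appLE _ _
          ((divisionSystem f h ϖ).preimage_toBase_lift U.1).le).hom with
        commutes' := appLE_lift_app_toBase f h ϖ U }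
    refine nonempty_algEquiv_blowupAlgebra hϖ (ι := ι)
      ((divisionSystem f h ϖ).appLE_lift_injective U)
      ((divisionSystem f h ϖ).range_appLE_lift U)
      (app_injective_of_ker_eq_bot hker U) (fun c hc ↦ ?_) (exists_pow_mul_eq_app f h U)
      (mem_ker_specialImageι f h hϖ U)
    refine eq_zero_of_toSections_mul (h ≫ f) (U.2.preimage h) hϖ.ne_zero ?_
    rw [← app_toSections]
    exact hc

end

variable {R : Type u} [CommRing R] [IsDomain R] [IsDiscreteValuationRing R]

/-- The hypotheses are chosen to pass to the lift: flatness is required of Y', which stays fixed,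
while the base only needs 𝒪_Y to inject into h_* 𝒪_{Y'}. The cover is pulled back at each stage with
the same index type. -/
theorem exists_isNeronComposite {ϖ : R} (hϖ : Irreducible ϖ) {ι : Type*} (n : ℕ) :
    ∀ {Y Y' : Scheme.{u}} (f : Y ⟶ base R) (h : Y' ⟶ Y) [IsAffineHom h] [Flat (h ≫ f)]
      (_ : h.ker = ⊥) [IsIso (h ∣_ invertOpen f ϖ)] (U : ι → Y.affineOpens)
      (_ : ⨆ i, (U i).1 = ⊤)
      -- Preimages under h and under its factorization are not definitionally equal; a variable V
      -- with an equation avoids transporting section rings.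
      (_ : ∀ i (V : Y'.Opens) (e : V = h ⁻¹ᵁ (U i).1),
        powDivisionRing (h.appLE (U i).1 V e.le).hom (toSections f (U i).1 ϖ) n = ⊤),
      ∃ (Z : Scheme.{u}) (c : Z ⟶ Y) (e : Y' ≅ Z), IsNeronComposite f c ∧ e.hom ≫ c = h := by
  induction n with
  | zero =>
    intro Y Y' f h _ _ hker _ U hU hgen
    have : IsIso h := by
      refine isIso_of_forall_isIso_app U hU fun i ↦ ?_
      refine (ConcreteCategory.isIso_iff_bijective _).mpr
        ⟨app_injective_of_ker_eq_bot hker (U i), ?_⟩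
      have := hgen i _ rfl
      rw [powDivisionRing_zero, ← Scheme.Hom.app_eq_appLE] at this
      exact RingHom.range_eq_top.mp this
    exact ⟨Y, 𝟙 Y, asIso h, .id f, Category.comp_id _⟩
  | succ n ih =>
    intro Y Y' f h _ _ hker _ U hU hgen
    set S := divisionSystem f h ϖ
    have hSf : S.lift ≫ S.toBase ≫ f = h ≫ f := by rw [reassoc_of% S.lift_toBase]
    have : Flat (S.lift ≫ S.toBase ≫ f) := by rwa [hSf]
    have := isIso_lift_restrict (f := f) (h := h) (ϖ := ϖ) hker
    obtain ⟨Z, c, e, hc, he⟩ := ih (S.toBase ≫ f) S.lift (ker_lift f h ϖ)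
      (fun i ↦ ⟨_, (U i).2.preimage S.toBase⟩) (preimage_iSup_affineOpens _ hU) (by
        intro i V e
        obtain rfl : V = h ⁻¹ᵁ (U i).1 := e.trans (S.preimage_toBase_lift _).symm
        have := powDivisionRing_succ_le (θ := (h.app (U i).1).hom)
          (appLE_lift_app_toBase f h ϖ (U i)) (S.range_appLE_lift (U i)) n
        have hg := hgen i _ rfl
        rw [← Scheme.Hom.app_eq_appLE] at hg
        rw [hg, top_le_iff, app_toSections] at this
        exact this)
    exact ⟨Z, c ≫ S.toBase, e, .comp f _ _ (isNeronBlowingUp_toBase hϖ hker) c hc, by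
      rw [reassoc_of% he, SubringSystem.lift_toBase]⟩

end NeronBlowup

/-! ### A uniform exponent, and the conclusion -/

namespace NeronBlowup

/-- The largest exponent among finitely many generators suffices. Every larger n works too, which
permits a maximum over a finite cover. -/
lemma exists_powDivisionRing_eq_top {A B : Type*} [CommRing A] [CommRing B] {θ : A →+* B}
    (hθ : θ.FiniteType) {s : A} (H : ∀ b, ∃ (n : ℕ) (a : A), θ s ^ n * b = θ a) :
    ∃ N, ∀ n ≥ N, powDivisionRing θ s n = ⊤ := by
  let := θ.toAlgebra
  obtain ⟨g, hg⟩ : (⊤ : Subalgebra A B).FG := hθ.out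
  choose m a ha using H
  refine ⟨g.sup m, fun n hn ↦ top_le_iff.mp fun b _ ↦ ?_⟩
  have hb : b ∈ (Algebra.adjoin A (g : Set B)).toSubring := by rw [hg]; trivial
  rw [Algebra.adjoin_eq_ring_closure] at hb
  refine Subring.closure_mono (Set.union_subset_union le_rfl fun x hx ↦ ?_) hb
  have hmn : m x ≤ n := (Finset.le_sup hx).trans hn
  exact ⟨s ^ (n - m x) * a x, by
    rw [map_mul, map_pow, ← ha, ← mul_assoc, ← pow_add, Nat.sub_add_cancel hmn]⟩

end NeronBlowup

end

theorem lemma3p9 (R : Type u) [CommRing R] [IsDomain R] [IsDiscreteValuationRing R]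
    [IsAdicComplete (IsLocalRing.maximalIdeal R) R]
    [IsAlgClosed (IsLocalRing.ResidueField R)]
    (p : ℕ) [Fact p.Prime] [CharP (IsLocalRing.ResidueField R) p]
    {Y Y' : Scheme.{u}} (f : Y ⟶ NeronBlowup.base R) (f' : Y' ⟶ NeronBlowup.base R)
    [Flat f] [Surjective f] [LocallyOfFiniteType f] [QuasiCompact f]
    [Flat f'] [Surjective f'] [LocallyOfFiniteType f'] [QuasiCompact f']
    (h : Y' ⟶ Y) (hS : h ≫ f = f') [IsAffineHom h] (hmodel : NeronBlowup.IsModelMap f h) :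
    ∃ (Z : Scheme.{u}) (c : Z ⟶ Y) (e : Y' ≅ Z),
      NeronBlowup.IsNeronComposite f c ∧ e.hom ≫ c = h := by
  subst hS
  obtain ⟨ϖ, hϖ⟩ := IsDiscreteValuationRing.exists_irreducible R
  have := NeronBlowup.isIso_of_isModelMap hmodel hϖ
  have hft : LocallyOfFiniteType h := locallyOfFiniteType_of_comp h f
  have hker : h.ker = ⊥ := NeronBlowup.ker_eq_bot_of_app_injective id
    (iSup_affineOpens_eq_top Y) (NeronBlowup.app_injective_of_flat f h hϖ.ne_zero)
  have : CompactSpace Y := QuasiCompact.compactSpace_of_compactSpace f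
  obtain ⟨s, hs⟩ := isCompact_univ.elim_finite_subcover
    (fun U : Y.affineOpens ↦ (U.1 : Set Y)) (fun U ↦ U.1.2) fun x _ ↦ by
      obtain ⟨U, hU⟩ := TopologicalSpace.Opens.mem_iSup.mp
        ((iSup_affineOpens_eq_top Y).ge (Set.mem_univ x))
      exact Set.mem_iUnion.mpr ⟨U, hU⟩
  have hN (U : Y.affineOpens) := NeronBlowup.exists_powDivisionRing_eq_top
    (θ := (h.app U.1).hom) (by
      rw [Scheme.Hom.app_eq_appLE]
      exact h.finiteType_appLE U.2 (U.2.preimage h) le_rfl)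
    (NeronBlowup.exists_pow_mul_eq_app f h (ϖ := ϖ) U)
  choose N hN using hN
  -- The number of blowing ups is the maximum of the local exponents over the finite subcover.
  refine NeronBlowup.exists_isNeronComposite hϖ (s.sup N) f h hker (fun U : s ↦ U.1) ?_ ?_
  · refine top_le_iff.mp fun x _ ↦ ?_
    obtain ⟨U, hU, hx⟩ := Set.mem_iUnion₂.mp (hs (Set.mem_univ x))
    exact TopologicalSpace.Opens.mem_iSup.mpr ⟨⟨U, hU⟩, hx⟩
  · rintro ⟨U, hU⟩ V rfl
    rw [Scheme.Hom.appLE_eq_app]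
    exact hN U _ (Finset.le_sup hU)
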